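/- Let $n\ge 2$ be an integer and let $\beta$ be a complex number with $|\beta|\le 1$. Let $S(n,\beta)$ be the set of polynomials of degree $n$ with complex coefficients, all of whose roots lie in the closed unit disk and at least one of whose roots is $\beta$. For $P\in S(n,\beta)$ let $|P|_\beta$ be the distance between $\beta$ and the closest root of the derivative $P'$, and let $r_n(\beta)=\sup\{|P|_\beta : P\in S(n,\beta)\}$. Then there is a $\delta>0$ such that for every $\beta\in\mathbb{C}$ with $1-\delta<|\beta|<1$ (in particular, for every real $\beta\in(1-\delta,1)$) we have $r_6(\beta)<r_4(\beta)$; consequently, for each such $\beta$, the sequence $n\mapsto r_n(\beta)$, $n\ge2$, is not monotone increasing. -/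

import Mathlib

noncomputable section

/-- `S(n, β)`: the complex polynomials of degree `n` with all roots in the closed unit disk
and at least one root at `β`. -/
def sendovClass (n : ℕ) (β : ℂ) : Set (Polynomial ℂ) :=
  {P | P.degree = (n : WithBot ℕ) ∧ (∀ z : ℂ, P.IsRoot z → ‖z‖ ≤ 1) ∧ P.IsRoot β}

/-- `|P|_β`: the distance between `β` and the closest root of the derivative `P'`.
For `P` of degree at least `2` the set of these roots is finite and nonempty, so that the
infimum of the distances is attained. -/
def critDist (P : Polynomial ℂ) (β : ℂ) : ℝ :=
  Metric.infDist β {z : ℂ | (Polynomial.derivative P).IsRoot z}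

/-- The Sendov radius `r_n(β) = sup {|P|_β : P ∈ S(n, β)}`.
For `n ≥ 2` and `|β| ≤ 1` the set is nonempty (take `(z - β)^n`) and bounded above by `2`
(Gauss-Lucas), so that the supremum is a genuine one. -/
def sendovRadius (n : ℕ) (β : ℂ) : ℝ :=
  sSup ((fun P : Polynomial ℂ => critDist P β) '' sendovClass n β)

end

open Polynomial ComplexConjugate

/-! Rotation reduces to real `β = 1 - e`, where the two radii are separated at first order in `e`.
An explicit quartic has all its critical points at distance `1 - e/3 + O(e²)` from `β`, so `r_4 ≥ 1
- 17/50 e` (`le_sendovRadius_four`). For sextics the argument gives a first-order coefficient of at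
least `11/30`; `7/20` lies between `17/50` and `11/30` (`sendovRadius_six_le`).

For the sextic bound put `e = s²` and suppose every critical point is at distance at least `1 - 7/20
s²`. Then all of them are `O(s)` with real parts `O(s²)` (`critical_points_bounds`), so `P` is close
to `z⁶ - 1`. At a sixth root of unity `w`, `|P|` does not decrease radially and `w P'(w) = 6 +
O(s)`, so `Re P(w)` is almost nonnegative. Combining this at `-1` and the two primitive cube roots
of unity bounds `Re(E₁ - E₂)` below, where `E₁, E₂` are elementary symmetric functions of the
critical points; the distance hypothesis bounds it above by something smaller
(`sextic_contradiction`). -/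

/-! ### Boundedness of the critical distance and rotation invariance. -/

theorem exists_isRoot_derivative {P : ℂ[X]} {n : ℕ} (hn : 2 ≤ n) (hP : P.degree = n) :
    ∃ z, P.derivative.IsRoot z := by
  apply IsAlgClosed.exists_root
  have h : P.natDegree = n := natDegree_eq_of_degree_eq_some hP
  rw [degree_derivative (by omega), h]
  exact_mod_cast (by omega : n - 1 ≠ 0)

theorem norm_le_one_of_isRoot_derivative {P : ℂ[X]} (hP : 0 < P.degree)
    (hr : ∀ z, P.IsRoot z → ‖z‖ ≤ 1) (hd : P.derivative ≠ 0) {z : ℂ}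
    (hz : P.derivative.IsRoot z) : ‖z‖ ≤ 1 := by
  have h1 : z ∈ P.derivative.rootSet ℂ := by
    rw [mem_rootSet]
    exact ⟨hd, by simpa using hz⟩
  have h2 := rootSet_derivative_subset_convexHull_rootSet hP h1
  have h3 : convexHull ℝ (P.rootSet ℂ) ⊆ Metric.closedBall 0 1 := by
    apply convexHull_min _ (convex_closedBall _ _)
    intro w hw
    rw [mem_rootSet] at hw
    simpa using hr w (by simpa using hw.2)
  simpa using h3 h2

theorem bddAbove_critDist {n : ℕ} (hn : 2 ≤ n) {β : ℂ} :
    BddAbove ((fun P : ℂ[X] => critDist P β) '' sendovClass n β) := by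
  refine ⟨‖β‖ + 1, ?_⟩
  rintro _ ⟨P, ⟨hP, hr, -⟩, rfl⟩
  obtain ⟨z, hz⟩ := exists_isRoot_derivative hn hP
  have hN : P.natDegree = n := natDegree_eq_of_degree_eq_some hP
  have hd : P.derivative ≠ 0 := by
    rw [Ne, derivative_eq_zero]
    omega
  have h0 : 0 < P.degree := by
    rw [hP]
    exact_mod_cast (by omega : 0 < n)
  have h1 := norm_le_one_of_isRoot_derivative h0 hr hd hz
  have h2 : critDist P β ≤ dist β z := Metric.infDist_le_dist_of_mem hz
  have h3 : dist β z ≤ ‖β‖ + ‖z‖ := by rw [dist_eq_norm]; exact norm_sub_le _ _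
  show critDist P β ≤ _
  linarith

theorem image_critDist_subset_rotate (n : ℕ) (b : ℂ) {u : ℂ} (hu : ‖u‖ = 1) :
    (fun P : ℂ[X] => critDist P b) '' sendovClass n b ⊆
      (fun P : ℂ[X] => critDist P (u * b)) '' sendovClass n (u * b) := by
  have hu0 : u ≠ 0 := by rintro rfl; simp at hu
  rintro _ ⟨P, ⟨hP, hr, hb⟩, rfl⟩
  have hdeg : (C u⁻¹ * X : ℂ[X]).natDegree = 1 := natDegree_C_mul_X _ (inv_ne_zero hu0)
  refine ⟨P.comp (C u⁻¹ * X), ⟨?_, ?_, ?_⟩, ?_⟩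
  · have hP0 : P ≠ 0 := by rintro rfl; simp at hP
    have hN : P.natDegree = n := natDegree_eq_of_degree_eq_some hP
    have h0 : P.comp (C u⁻¹ * X) ≠ 0 := by
      intro h
      rw [comp_C_mul_X_eq_zero_iff] at h
      · exact hP0 h
      · exact mem_nonZeroDivisors_of_ne_zero (inv_ne_zero hu0)
    rw [degree_eq_natDegree h0, natDegree_comp, hdeg, hN, mul_one]
  · intro z hz
    have := hr (u⁻¹ * z) (by simpa [IsRoot.def, eval_comp] using hz)
    simpa [hu] using this
  · simpa [IsRoot.def, eval_comp, hu0] using hb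
  · have hiso : Isometry (fun z : ℂ => u * z) := by
      apply Isometry.of_dist_eq
      intro x y
      rw [dist_eq_norm, dist_eq_norm, ← mul_sub, norm_mul, hu, one_mul]
    show critDist _ _ = critDist _ _
    unfold critDist
    rw [← Metric.infDist_image hiso (x := b)]
    refine congrArg (Metric.infDist (u * b)) (Set.ext fun z => ?_)
    simp only [Set.mem_ofPred_eq, Set.mem_image, IsRoot.def, derivative_comp, eval_mul, eval_comp,
      derivative_C_mul, derivative_X, eval_C, eval_X, mul_one]
    constructor
    · intro h
      refine ⟨u⁻¹ * z, ?_, by field_simp⟩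
      rcases mul_eq_zero.1 h with h | h
      · exact absurd h (inv_ne_zero hu0)
      · exact h
    · rintro ⟨w, hw, rfl⟩
      rw [inv_mul_cancel_left₀ hu0, hw, mul_zero]

theorem sendovRadius_rotate (n : ℕ) (b : ℂ) {u : ℂ} (hu : ‖u‖ = 1) :
    sendovRadius n (u * b) = sendovRadius n b := by
  have hu0 : u ≠ 0 := by rintro rfl; simp at hu
  unfold sendovRadius
  congr 1
  refine Set.Subset.antisymm ?_ (image_critDist_subset_rotate n b hu)
  have := image_critDist_subset_rotate n (u * b) (u := u⁻¹) (by simp [hu])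
  rwa [inv_mul_cancel_left₀ hu0] at this

theorem sendovRadius_eq_norm (n : ℕ) (β : ℂ) (hβ : β ≠ 0) :
    sendovRadius n β = sendovRadius n (‖β‖ : ℂ) := by
  have h0 : (‖β‖ : ℂ) ≠ 0 := by simpa using hβ
  have hu : ‖β / ‖β‖‖ = 1 := by simp [hβ]
  rw [← sendovRadius_rotate n (‖β‖ : ℂ) hu, div_mul_cancel₀ _ h0]

/-! ### Degree 4: the extremal-type quartic and the lower bound. -/

theorem norm_eq_one_of_sq_sub_two_mul_add_one {p : ℝ} (hp : p ^ 2 ≤ 1) {z : ℂ}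
    (hz : z ^ 2 - 2 * p * z + 1 = 0) : ‖z‖ = 1 := by
  have hre := congrArg Complex.re hz
  have him := congrArg Complex.im hz
  simp [pow_two] at hre him
  have h : ‖z‖ ^ 2 = 1 := by
    rw [Complex.sq_norm, Complex.normSq_apply]
    have h2 : z.im * (z.re - p) = 0 := by linarith
    rcases mul_eq_zero.1 h2 with h | h
    · rw [h] at hre ⊢
      have h3 : (z.re - p) ^ 2 = 0 := by nlinarith [sq_nonneg (z.re - p)]
      have h4 : z.re = p := by
        have := pow_eq_zero_iff (two_ne_zero) |>.1 h3
        linarith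
      rw [h4] at hre ⊢
      nlinarith
    · have h4 : z.re = p := by linarith
      rw [h4] at hre ⊢
      nlinarith
  rw [← Real.sqrt_sq (norm_nonneg z), h, Real.sqrt_one]

/-- The distance from a real number to a non-real root of a real quadratic `4 z² + B z + D`. -/
theorem sq_norm_sub_of_quadratic {B D : ℝ} (hdisc : B ^ 2 < 16 * D) {z : ℂ}
    (hz : 4 * z ^ 2 + B * z + D = 0) (b : ℝ) :
    ‖(b : ℂ) - z‖ ^ 2 = b ^ 2 + B * b / 4 + D / 4 := by
  have hre := congrArg Complex.re hz
  have him := congrArg Complex.im hz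
  simp [pow_two] at hre him
  rw [Complex.sq_norm, Complex.normSq_apply]
  simp only [Complex.sub_re, Complex.sub_im, Complex.ofReal_re, Complex.ofReal_im]
  have h2 : z.im * (8 * z.re + B) = 0 := by linarith
  rcases mul_eq_zero.1 h2 with h | h
  · rw [h] at hre
    nlinarith [sq_nonneg (8 * z.re + B)]
  · have h4 : z.re = - B / 8 := by linarith
    rw [h4] at hre ⊢
    nlinarith

theorem le_sendovRadius_four {e : ℝ} (he : 0 < e) (he' : e ≤ 1 / 100) :
    1 - 17 / 50 * e ≤ sendovRadius 4 ((1 - e : ℝ) : ℂ) := by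
  have hb : (1 - e) ≠ 0 := by linarith
  -- This is the condition that `-2e/3` be a root of `P'`; in particular `p ≈ -e/2`.
  obtain ⟨p, hp⟩ : ∃ p : ℝ, 2 * p * (1 - e) = -(e - 4 / 3 * e ^ 2 + 4 / 27 * e ^ 3) :=
    ⟨-(e - 4 / 3 * e ^ 2 + 4 / 27 * e ^ 3) / (2 * (1 - e)), by field_simp⟩
  have hp0 : p ≤ 0 := by
    by_contra! h
    nlinarith [mul_pos h (by linarith : 0 < 1 - e), pow_pos he 2, pow_pos he 3]
  have hp1 : -e ≤ p := by
    by_contra! h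
    nlinarith [mul_lt_mul_of_pos_right h (by linarith : 0 < 1 - e), pow_pos he 2, pow_pos he 3,
      mul_le_mul_of_nonneg_left he' (sq_nonneg e)]
  have hpc : 2 * (p : ℂ) * (1 - e) = -(e - 4 / 3 * e ^ 2 + 4 / 27 * e ^ 3) := by
    simpa using congrArg Complex.ofReal hp
  set P : ℂ[X] := (X - C ((1 - e : ℝ) : ℂ)) * ((X + 1) * (X ^ 2 - 2 * C (p : ℂ) * X + 1)) with hPdef
  have hev : ∀ z, P.eval z = (z - (1 - e : ℝ)) * ((z + 1) * (z ^ 2 - 2 * p * z + 1)) := by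
    intro z
    simp [hPdef]
  have hder : ∀ z, P.derivative.eval z =
      (z + 2 / 3 * e) * (4 * z ^ 2 + ((3 * (e - 2 * p) - 8 / 3 * e : ℝ) : ℂ) * z +
        ((2 * e * (1 - 2 * p) - 2 / 3 * e * (3 * (e - 2 * p) - 8 / 3 * e) : ℝ) : ℂ)) := by
    intro z
    simp [hPdef]
    linear_combination hpc
  have hdeg : P.degree = (4 : ℕ) := by
    rw [hPdef]
    compute_degree!
  have hmem : P ∈ sendovClass 4 ((1 - e : ℝ) : ℂ) := by
    refine ⟨hdeg, ?_, ?_⟩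
    · intro z hz
      rw [IsRoot.def, hev] at hz
      rcases mul_eq_zero.1 hz with h | h
      · rw [sub_eq_zero.1 h, Complex.norm_real, Real.norm_eq_abs, abs_le]
        constructor <;> linarith
      · rcases mul_eq_zero.1 h with h | h
        · rw [eq_neg_of_add_eq_zero_left h]
          simp
        · exact (norm_eq_one_of_sq_sub_two_mul_add_one (by nlinarith) h).le
    · rw [IsRoot.def, hev]
      simp
  refine le_trans ?_ (le_csSup (bddAbove_critDist (by norm_num)) ⟨P, hmem, rfl⟩)
  -- Nonemptiness matters: `Metric.infDist` to the empty set is `0`.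
  obtain ⟨z₀, hz₀⟩ := exists_isRoot_derivative (by norm_num) hdeg
  refine (Metric.le_infDist ⟨z₀, hz₀⟩).2 fun z hz => ?_
  rw [dist_eq_norm]
  replace hz : P.derivative.eval z = 0 := hz
  rw [hder] at hz
  rcases mul_eq_zero.1 hz with h | h
  · have : ((1 - e : ℝ) : ℂ) - z = ((1 - e + 2 / 3 * e : ℝ) : ℂ) := by
      push_cast
      linear_combination -h
    rw [this, Complex.norm_real, Real.norm_eq_abs]
    exact le_trans (by linarith) (le_abs_self _)
  -- To first order the quadratic is `4z² + (10/3)e z + 2e`, so the squared distance is `1 - 2e/3 +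
  -- O(e²)`, matching the linear factor.
  · have h1 := sq_norm_sub_of_quadratic ?_ h (1 - e)
    · apply le_of_sq_le_sq _ (norm_nonneg _)
      rw [h1]
      nlinarith [mul_le_mul_of_nonneg_left he' he.le, pow_pos he 3]
    · nlinarith [mul_le_mul_of_nonneg_left he' he.le, mul_nonneg he.le (neg_nonneg.2 hp0)]

/-! ### Degree 6: logarithmic derivatives and localization of the critical points. -/

theorem re_sum_map {ι : Type*} (m : Multiset ι) (f : ι → ℂ) :
    (m.map f).sum.re = (m.map fun i => (f i).re).sum := by
  induction m using Multiset.induction with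
  | empty => simp
  | cons a m ih => simp [ih]

theorem le_sum_map_of_forall_le {ι : Type*} (m : Multiset ι) (f : ι → ℝ) (c : ℝ)
    (h : ∀ i ∈ m, c ≤ f i) : m.card * c ≤ (m.map f).sum := by
  induction m using Multiset.induction with
  | empty => simp
  | cons a m ih =>
    have h1 := ih fun i hi => h i (Multiset.mem_cons_of_mem hi)
    have h2 := h a (Multiset.mem_cons_self a m)
    simp only [Multiset.card_cons, Multiset.map_cons, Multiset.sum_cons]
    push_cast
    linarith

theorem sum_map_le_of_forall_le {ι : Type*} (m : Multiset ι) (f : ι → ℝ) (c : ℝ)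
    (h : ∀ i ∈ m, f i ≤ c) : (m.map f).sum ≤ m.card * c := by
  have := le_sum_map_of_forall_le m (fun i => - f i) (-c) fun i hi => neg_le_neg (h i hi)
  rw [Multiset.sum_map_neg] at this
  linarith

theorem norm_prod_map {ι : Type*} (m : Multiset ι) (f : ι → ℂ) :
    ‖(m.map f).prod‖ = (m.map fun i => ‖f i‖).prod := by
  induction m using Multiset.induction with
  | empty => simp
  | cons a m ih => simp [ih]

theorem prod_map_le_pow {ι : Type*} (m : Multiset ι) (f : ι → ℝ) (c : ℝ) (hf : ∀ i, 0 ≤ f i)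
    (hc : 0 ≤ c) (h : ∀ i ∈ m, f i ≤ c) : (m.map f).prod ≤ c ^ m.card := by
  induction m using Multiset.induction with
  | empty => simp
  | cons a m ih =>
    have h1 := ih fun i hi => h i (Multiset.mem_cons_of_mem hi)
    have h2 := h a (Multiset.mem_cons_self a m)
    simp only [Multiset.card_cons, Multiset.map_cons, Multiset.prod_cons, pow_succ']
    exact mul_le_mul h2 h1 (Multiset.prod_nonneg (by simp; intro i _; exact hf i)) hc

theorem pow_le_prod_map {ι : Type*} (m : Multiset ι) (f : ι → ℝ) (c : ℝ)
    (hc : 0 ≤ c) (h : ∀ i ∈ m, c ≤ f i) : c ^ m.card ≤ (m.map f).prod := by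
  induction m using Multiset.induction with
  | empty => simp
  | cons a m ih =>
    have h1 := ih fun i hi => h i (Multiset.mem_cons_of_mem hi)
    have h2 := h a (Multiset.mem_cons_self a m)
    simp only [Multiset.card_cons, Multiset.map_cons, Multiset.prod_cons, pow_succ']
    exact mul_le_mul h2 h1 (pow_nonneg hc _) (hc.trans h2)

/-- On the unit circle, the modulus of a polynomial with all roots in the closed unit disk does not
decrease in the radial direction. -/
theorem re_mul_derivative_mul_conj_nonneg {P : ℂ[X]} (hr : ∀ z, P.IsRoot z → ‖z‖ ≤ 1) {w : ℂ}
    (hw : ‖w‖ = 1) : 0 ≤ (w * P.derivative.eval w * conj (P.eval w)).re := by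
  by_cases h0 : P.eval w = 0
  · simp [h0]
  have hP0 : P ≠ 0 := by rintro rfl; simp at h0
  have h1 := (IsAlgClosed.splits P).eval_derivative_div_eval_of_ne_zero h0
  rw [div_eq_iff h0] at h1
  have h2 : w * P.derivative.eval w * conj (P.eval w) =
      ((Complex.normSq (P.eval w) : ℝ) : ℂ) * (P.roots.map fun z => w * (1 / (w - z))).sum := by
    rw [h1, Multiset.sum_map_mul_left, Complex.normSq_eq_conj_mul_self]
    ring
  rw [h2, Complex.re_ofReal_mul, re_sum_map]
  refine mul_nonneg (Complex.normSq_nonneg _) ?_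
  have := le_sum_map_of_forall_le P.roots (fun z => (w * (1 / (w - z))).re) 0 ?_
  · simpa using this
  · intro z hz
    have hz1 := hr z (isRoot_of_mem_roots hz)
    rw [mul_one_div, Complex.div_re, ← add_div]
    refine div_nonneg ?_ (Complex.normSq_nonneg _)
    have e1 : ‖w‖ ^ 2 = 1 := by rw [hw]; norm_num
    have e2 : ‖z‖ ^ 2 ≤ 1 := by nlinarith [norm_nonneg z]
    rw [Complex.sq_norm, Complex.normSq_apply] at e1 e2
    simp only [Complex.sub_re, Complex.sub_im]
    nlinarith [sq_nonneg (w.re - z.re), sq_nonneg (w.im - z.im)]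

/-- If `z` is in the closed unit disk and not too close to `b = 1 - e`, then `1 / (b - z)` almost
lies in the half-plane `1 / 2 ≤ re`. -/
theorem re_inv_sub_lower_bound {e : ℝ} (he : 0 < e) (he' : e ≤ 1 / 1000) {z : ℂ} (hz : ‖z‖ ≤ 1)
    (hd : 5 / 16 ≤ ‖((1 - e : ℝ) : ℂ) - z‖) :
    1 / 2 - 21 / 2 * e ≤ (1 / (((1 - e : ℝ) : ℂ) - z)).re := by
  have e2 : ‖z‖ ^ 2 ≤ 1 := by nlinarith [norm_nonneg z]
  have e3 : (5 / 16) ^ 2 ≤ ‖((1 - e : ℝ) : ℂ) - z‖ ^ 2 := by gcongr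
  rw [Complex.sq_norm, Complex.normSq_apply] at e2 e3
  rw [one_div (_ - _), Complex.inv_re, Complex.normSq_apply, le_div_iff₀ (lt_of_lt_of_le (by norm_num) e3)]
  simp only [Complex.sub_re, Complex.sub_im, Complex.ofReal_re, Complex.ofReal_im] at *
  set N := (1 - e - z.re) * (1 - e - z.re) + (0 - z.im) * (0 - z.im) with hN
  -- With `b = 1 - e`, `2b(b - Re z) = N + b² - |z|²`; the `21` below comes from `2 · (16/5)² < 21`.
  have h1 : N - 2 * e ≤ 2 * (1 - e) * (1 - e - z.re) := by nlinarith
  have h2 : (1 - 21 * e) * N ≤ N - 2 * e := by nlinarith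
  have h3 : 0 ≤ 1 - e - z.re := by
    by_contra! h
    nlinarith
  nlinarith

theorem dist_one_le_of_re {s : ℝ} (hs : 0 < s) (hs' : s ≤ 1 / 1000) {u : ℂ}
    (h1 : ‖u‖ ≤ 1 + s ^ 2) (h2 : 1 - 109 * s ^ 2 ≤ u.re) : ‖u - 1‖ ≤ 15 * s := by
  apply le_of_sq_le_sq _ (by positivity)
  have h3 : ‖u‖ ^ 2 ≤ (1 + s ^ 2) ^ 2 := by gcongr
  rw [Complex.sq_norm, Complex.normSq_apply] at *
  simp only [Complex.sub_re, Complex.sub_im, Complex.one_re, Complex.one_im]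
  have : s ^ 2 ≤ 1 := by nlinarith
  nlinarith [sq_nonneg s]

/-- A critical point `ζ`, in terms of `u = 1 / (1 - s² - ζ)`. -/
theorem bounds_of_inv_bounds {s : ℝ} (hs : 0 < s) (hs' : s ≤ 1 / 1000) {u ζ : ℂ}
    (hζ : u * (((1 - s ^ 2 : ℝ) : ℂ) - ζ) = 1) (h1 : ‖u‖ ≤ 1 + s ^ 2)
    (h2 : 1 - 109 * s ^ 2 ≤ u.re) : ‖ζ‖ ≤ 17 * s ∧ |ζ.re| ≤ 115 * s ^ 2 := by
  have hs2 : s ^ 2 ≤ 1 / 1000 * s := by nlinarith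
  have hu1 : ‖u - 1‖ ≤ 15 * s := dist_one_le_of_re hs hs' h1 h2
  have hre : u.re ≤ ‖u‖ := Complex.re_le_norm u
  have hu0 : u ≠ 0 := by rintro rfl; simp at hζ
  constructor
  · have e1 : u * ζ = (u - 1) - ((s ^ 2 : ℝ) : ℂ) * u := by
      push_cast at *
      linear_combination -hζ
    have e2 : ‖u‖ * ‖ζ‖ ≤ 15 * s + s ^ 2 * (1 + s ^ 2) := by
      rw [← norm_mul, e1]
      refine (norm_sub_le _ _).trans (add_le_add hu1 ?_)
      rw [norm_mul, Complex.norm_real, Real.norm_eq_abs, abs_of_nonneg (by positivity)]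
      gcongr
    have e3 : (99 / 100) * ‖ζ‖ ≤ ‖u‖ * ‖ζ‖ := by
      gcongr
      nlinarith
    nlinarith
  · have e1 : ζ.re = 1 - s ^ 2 - u.re / ‖u‖ ^ 2 := by
      have : ζ = ((1 - s ^ 2 : ℝ) : ℂ) - u⁻¹ := by
        field_simp
        linear_combination -hζ
      rw [this, Complex.sub_re, Complex.ofReal_re, Complex.inv_re, Complex.sq_norm]
    have hpos : 0 < ‖u‖ := norm_pos_iff.2 hu0
    have hr : 99 / 100 ≤ u.re := by nlinarith
    have e2 : u.re / ‖u‖ ^ 2 ≤ 1 + 111 * s ^ 2 := by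
      rw [div_le_iff₀ (by positivity)]
      have : u.re ^ 2 ≤ ‖u‖ ^ 2 := by gcongr
      have h5 : 1 ≤ (1 + 111 * s ^ 2) * u.re := by nlinarith [sq_nonneg s]
      nlinarith [sq_nonneg s]
    have e3 : 1 - 113 * s ^ 2 ≤ u.re / ‖u‖ ^ 2 := by
      rw [le_div_iff₀ (by positivity)]
      have h5 : ‖u‖ ^ 2 ≤ (1 + s ^ 2) ^ 2 := by gcongr
      have h6 : 0 ≤ 1 - 113 * s ^ 2 := by nlinarith
      have h7 : (1 - 113 * s ^ 2) * ‖u‖ ^ 2 ≤ (1 - 113 * s ^ 2) * (1 + s ^ 2) ^ 2 := by gcongr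
      have h8 : s ^ 2 ≤ 1 := by nlinarith
      nlinarith [sq_nonneg s, mul_nonneg (sq_nonneg s) (sq_nonneg s), pow_pos hs 6]
    rw [e1, abs_le]
    constructor <;> nlinarith

/-- Writing `P = (X - b) Q`, one has `P''(b)/P'(b) = 2 Q'(b)/Q(b)`, i.e. `∑ 1/(b - ζ) = 2 ∑ 1/(b -
z)` over critical points `ζ` and roots `z` of `Q`. The right side has real part at least `5 - 105
s²`, while each of the five terms on the left has modulus at most `1 + s²`. Hence every term on the
left has real part at least `1 - 109 s²`, which pins `1/(b - ζ)` near `1`. -/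
theorem critical_points_bounds {s : ℝ} (hs : 0 < s) (hs' : s ≤ 1 / 1000) {P : ℂ[X]}
    (hm : P.Monic) (hP : P ∈ sendovClass 6 ((1 - s ^ 2 : ℝ) : ℂ))
    (hc : ∀ z, P.derivative.IsRoot z → 1 - 7 / 20 * s ^ 2 ≤ ‖((1 - s ^ 2 : ℝ) : ℂ) - z‖) {ζ : ℂ}
    (hζ : P.derivative.IsRoot ζ) : ‖ζ‖ ≤ 17 * s ∧ |ζ.re| ≤ 115 * s ^ 2 := by
  obtain ⟨hdeg, hr, hb⟩ := hP
  set b : ℂ := ((1 - s ^ 2 : ℝ) : ℂ) with hbdef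
  have hs2 : s ^ 2 ≤ 1 / 1000000 := by nlinarith
  have hN : P.natDegree = 6 := natDegree_eq_of_degree_eq_some hdeg
  obtain ⟨Q, hQ⟩ := dvd_iff_isRoot.2 hb
  have hQm : Q.Monic := by
    rw [hQ] at hm
    exact (monic_X_sub_C b).of_mul_monic_left hm
  have hQN : Q.natDegree = 5 := by
    have := (monic_X_sub_C b).natDegree_mul hQm
    rw [← hQ, hN, natDegree_X_sub_C] at this
    omega
  have hD0 : P.derivative ≠ 0 := by
    rw [Ne, derivative_eq_zero]
    omega
  have hDN : P.derivative.natDegree = 5 := by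
    rw [natDegree_derivative, hN]
  have hDl : P.derivative.leadingCoeff = 6 := by
    rw [leadingCoeff, hDN, coeff_derivative]
    have : P.coeff 6 = 1 := by rw [← hN]; exact hm
    norm_num [this]
  have hder1 : P.derivative.eval b = Q.eval b := by
    rw [hQ]
    simp
  have hder2 : P.derivative.derivative.eval b = 2 * Q.derivative.eval b := by
    rw [hQ]
    simp
    ring
  have hcardD : P.derivative.roots.card = 5 := by
    rw [← (IsAlgClosed.splits P.derivative).natDegree_eq_card_roots, hDN]
  have hcardQ : Q.roots.card = 5 := by
    rw [← (IsAlgClosed.splits Q).natDegree_eq_card_roots, hQN]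
  have hQr : ∀ z ∈ Q.roots, ‖z‖ ≤ 1 := fun z hz => hr z <| by
    rw [IsRoot.def, hQ, eval_mul, isRoot_of_mem_roots hz, mul_zero]
  have hbn : ‖b‖ ≤ 1 := by
    rw [hbdef, Complex.norm_real, Real.norm_eq_abs, abs_le]
    constructor <;> nlinarith
  have hDev : 5 ≤ ‖P.derivative.eval b‖ := by
    rw [(IsAlgClosed.splits P.derivative).eval_eq_prod_roots, hDl, norm_mul, norm_prod_map]
    have h1 := pow_le_prod_map P.derivative.roots (fun z => ‖b - z‖) (1 - 7 / 20 * s ^ 2)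
      (by nlinarith) fun z hz => hc z (isRoot_of_mem_roots hz)
    rw [hcardD] at h1
    have h2 : (99 / 100 : ℝ) ^ 5 ≤ (1 - 7 / 20 * s ^ 2) ^ 5 := by
      gcongr
      linarith
    norm_num at h2 ⊢
    linarith
  have hQ0 : Q.eval b ≠ 0 := by
    intro h
    rw [hder1, h, norm_zero] at hDev
    norm_num at hDev
  -- `|Q(b)| = |P'(b)| ≥ 5`, and the other four factors are at most `2` each.
  have hfar : ∀ z ∈ Q.roots, 5 / 16 ≤ ‖b - z‖ := by
    intro z hz
    obtain ⟨t, ht⟩ := Multiset.exists_cons_of_mem hz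
    have htc : t.card = 4 := by
      have := congrArg Multiset.card ht
      rw [hcardQ, Multiset.card_cons] at this
      omega
    rw [hder1, (IsAlgClosed.splits Q).eval_eq_prod_roots, hQm.leadingCoeff, one_mul,
      norm_prod_map, ht, Multiset.map_cons, Multiset.prod_cons] at hDev
    have h1 := prod_map_le_pow t (fun z => ‖b - z‖) 2 (fun _ => norm_nonneg _) (by norm_num)
      fun w hw => by
        have := hQr w (by rw [ht]; exact Multiset.mem_cons_of_mem hw)
        linarith [norm_sub_le b w]
    rw [htc] at h1
    have h2 := mul_le_mul_of_nonneg_left h1 (norm_nonneg (b - z))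
    norm_num at h2
    linarith
  have hsumQ := (IsAlgClosed.splits Q).eval_derivative_div_eval_of_ne_zero hQ0
  have hsumD := (IsAlgClosed.splits P.derivative).eval_derivative_div_eval_of_ne_zero
    (x := b) (by rw [hder1]; exact hQ0)
  rw [hder1, hder2, mul_div_assoc, hsumQ] at hsumD
  have hsum := congrArg Complex.re hsumD
  rw [Complex.mul_re, re_sum_map, re_sum_map] at hsum
  simp only [Complex.re_ofNat, Complex.im_ofNat, zero_mul, sub_zero] at hsum
  have hlow := le_sum_map_of_forall_le Q.roots (fun z => (1 / (b - z)).re) _ fun z hz =>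
    re_inv_sub_lower_bound (by positivity) (by linarith) (hQr z hz) (hfar z hz)
  rw [hcardQ] at hlow
  have hinv : ∀ z ∈ P.derivative.roots, ‖1 / (b - z)‖ ≤ 1 + s ^ 2 := by
    intro z hz
    have h1 := hc z (isRoot_of_mem_roots hz)
    rw [norm_div, norm_one, div_le_iff₀ (by linarith)]
    nlinarith [sq_nonneg s]
  have hζm : ζ ∈ P.derivative.roots := (mem_roots hD0).2 hζ
  obtain ⟨t, ht⟩ := Multiset.exists_cons_of_mem hζm
  have htc : t.card = 4 := by
    have := congrArg Multiset.card ht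
    rw [hcardD, Multiset.card_cons] at this
    omega
  have hup := sum_map_le_of_forall_le t (fun z => (1 / (b - z)).re) (1 + s ^ 2) fun z hz =>
    (Complex.re_le_norm _).trans (hinv z (by rw [ht]; exact Multiset.mem_cons_of_mem hz))
  rw [htc] at hup
  rw [ht, Multiset.map_cons, Multiset.sum_cons] at hsum
  have hne : b - ζ ≠ 0 := by
    intro h
    have := hc ζ hζ
    rw [h, norm_zero] at this
    linarith
  refine bounds_of_inv_bounds hs hs' (u := 1 / (b - ζ)) (one_div_mul_cancel hne) (hinv ζ hζm) ?_
  push_cast at hlow hup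
  linarith

/-! ### Degree 6: expansions at sixth roots of unity. -/

theorem norm_add_mul_le {x y z : ℂ} {A B D : ℝ} (hx : ‖x‖ ≤ A) (hy : ‖y‖ ≤ B) (hz : ‖z‖ ≤ D) :
    ‖x + y * z‖ ≤ A + B * D := by
  refine (norm_add_le _ _).trans (add_le_add hx ?_)
  rw [norm_mul]
  exact mul_le_mul hy hz (norm_nonneg _) ((norm_nonneg _).trans hy)

/-- Meant for `x = P(w)` and `6 + 6T = w P'(w)`: radial monotonicity becomes near-nonnegativity of
`Re P(w)`. -/
theorem neg_mul_norm_le_re {x T : ℂ} {t : ℝ} (hT : ‖T‖ ≤ t)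
    (h : 0 ≤ ((6 + 6 * T) * conj x).re) : -(t * ‖x‖) ≤ x.re := by
  have h1 : ((6 + 6 * T) * conj x).re = 6 * (x.re + (T * conj x).re) := by
    simp [Complex.mul_re]
    ring
  have h2 : (T * conj x).re ≤ t * ‖x‖ := by
    refine (Complex.re_le_norm _).trans ?_
    rw [norm_mul, Complex.norm_conj]
    gcongr
  rw [h1] at h
  linarith

theorem elementary_symmetric_bounds {B : ℝ} {a₁ a₂ a₃ a₄ a₅ : ℂ} (h₁ : ‖a₁‖ ≤ B)
    (h₂ : ‖a₂‖ ≤ B) (h₃ : ‖a₃‖ ≤ B) (h₄ : ‖a₄‖ ≤ B) (h₅ : ‖a₅‖ ≤ B) :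
    ∃ E₁ E₂ E₃ E₄ E₅ : ℂ, E₁ = a₁ + a₂ + a₃ + a₄ + a₅ ∧
      2 * E₂ = E₁ ^ 2 - (a₁ ^ 2 + a₂ ^ 2 + a₃ ^ 2 + a₄ ^ 2 + a₅ ^ 2) ∧
      (∀ z, (z - a₁) * (z - a₂) * (z - a₃) * (z - a₄) * (z - a₅) =
        z ^ 5 - E₁ * z ^ 4 + E₂ * z ^ 3 - E₃ * z ^ 2 + E₄ * z - E₅) ∧
      ‖E₁‖ ≤ 5 * B ∧ ‖E₂‖ ≤ 10 * B ^ 2 ∧ ‖E₃‖ ≤ 10 * B ^ 3 ∧ ‖E₄‖ ≤ 5 * B ^ 4 ∧ ‖E₅‖ ≤ B ^ 5 := by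
  -- The letters `x, y, z, u, v` stand for `e₁, …, e₅` of the first few `aᵢ`, built by adjoining one
  -- variable at a time; the last of each supplies the witness.
  have x2 : ‖a₁ + a₂ * 1‖ ≤ _ := norm_add_mul_le h₁ h₂ norm_one.le
  have x3 := norm_add_mul_le x2 h₃ norm_one.le
  have x4 := norm_add_mul_le x3 h₄ norm_one.le
  have x5 := norm_add_mul_le x4 h₅ norm_one.le
  have y2 := norm_add_mul_le norm_zero.le h₂ h₁
  have y3 := norm_add_mul_le y2 h₃ x2
  have y4 := norm_add_mul_le y3 h₄ x3
  have y5 := norm_add_mul_le y4 h₅ x4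
  have z3 := norm_add_mul_le norm_zero.le h₃ y2
  have z4 := norm_add_mul_le z3 h₄ y3
  have z5 := norm_add_mul_le z4 h₅ y4
  have u4 := norm_add_mul_le norm_zero.le h₄ z3
  have u5 := norm_add_mul_le u4 h₅ z4
  have v5 := norm_add_mul_le norm_zero.le h₅ u4
  refine ⟨_, _, _, _, _, ?_, ?_, ?_, x5.trans_eq ?_, y5.trans_eq ?_, z5.trans_eq ?_,
    u5.trans_eq ?_, v5.trans_eq ?_⟩
  · ring
  · ring
  · intro z
    ring
  all_goals ring

theorem eval_eq_of_derivative {P : ℂ[X]} {b E₁ E₂ E₃ E₄ E₅ : ℂ} (hb : P.eval b = 0)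
    (hd : ∀ z, P.derivative.eval z =
      6 * (z ^ 5 - E₁ * z ^ 4 + E₂ * z ^ 3 - E₃ * z ^ 2 + E₄ * z - E₅)) (z : ℂ) :
    P.eval z = z ^ 6 - b ^ 6 - 6 / 5 * E₁ * (z ^ 5 - b ^ 5) + 3 / 2 * E₂ * (z ^ 4 - b ^ 4) -
      2 * E₃ * (z ^ 3 - b ^ 3) + 3 * E₄ * (z ^ 2 - b ^ 2) - 6 * E₅ * (z - b) := by
  set F : ℂ[X] := X ^ 6 - C (6 / 5 * E₁) * X ^ 5 + C (3 / 2 * E₂) * X ^ 4 - C (2 * E₃) * X ^ 3 +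
    C (3 * E₄) * X ^ 2 - C (6 * E₅) * X with hF
  have h0 : derivative (P - F) = 0 := by
    refine Polynomial.funext fun w => ?_
    rw [derivative_sub, eval_sub, hd, hF]
    simp
    ring
  obtain ⟨k, hk⟩ := natDegree_eq_zero.1 (derivative_eq_zero.1 h0)
  have hP : ∀ w, P.eval w = F.eval w + k := by
    intro w
    have := congrArg (eval w) hk
    rw [eval_C, eval_sub] at this
    rw [this]
    ring
  have h1 := hP b
  rw [hb] at h1
  have h2 : P.eval z = F.eval z - F.eval b := by
    rw [hP]
    linear_combination -h1
  rw [h2, hF]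
  simp
  ring

/-- Expansion at a sixth root of unity of a sextic vanishing at `1 - s²` whose critical points are
`O(s)`. -/
theorem eval_root_of_unity_expansion {s : ℝ} (hs : 0 < s) (hs' : s ≤ 1 / 10 ^ 10)
    {E₁ E₂ E₃ E₄ E₅ w : ℂ} (hw : ‖w‖ = 1) (hw6 : w ^ 6 = 1)
    (h₁ : ‖E₁‖ ≤ 5 * (17 * s)) (h₂ : ‖E₂‖ ≤ 10 * (17 * s) ^ 2) (h₃ : ‖E₃‖ ≤ 10 * (17 * s) ^ 3)
    (h₄ : ‖E₄‖ ≤ 5 * (17 * s) ^ 4) (h₅ : ‖E₅‖ ≤ (17 * s) ^ 5) :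
    ∃ R : ℂ, ‖R‖ ≤ 200000 * s ^ 3 ∧
      w ^ 6 - ((1 - s ^ 2 : ℝ) : ℂ) ^ 6 - 6 / 5 * E₁ * (w ^ 5 - ((1 - s ^ 2 : ℝ) : ℂ) ^ 5) +
        3 / 2 * E₂ * (w ^ 4 - ((1 - s ^ 2 : ℝ) : ℂ) ^ 4) -
        2 * E₃ * (w ^ 3 - ((1 - s ^ 2 : ℝ) : ℂ) ^ 3) +
        3 * E₄ * (w ^ 2 - ((1 - s ^ 2 : ℝ) : ℂ) ^ 2) - 6 * E₅ * (w - ((1 - s ^ 2 : ℝ) : ℂ)) =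
      6 * s ^ 2 - 6 / 5 * E₁ * (w ^ 5 - 1) + 3 / 2 * E₂ * (w ^ 4 - 1) + R := by
  set b : ℝ := 1 - s ^ 2 with hb
  have hs1 : s ^ 2 ≤ 1 / 10 ^ 20 := by
    calc s ^ 2 ≤ (1 / 10 ^ 10) ^ 2 := by gcongr
      _ = _ := by norm_num
  have hb0 : 0 ≤ b := by norm_num at hs1; linarith
  have hb1 : b ≤ 1 := by nlinarith
  have hbn : ∀ k : ℕ, ‖w ^ k - (b : ℂ) ^ k‖ ≤ 2 := by
    intro k
    refine (norm_sub_le _ _).trans ?_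
    rw [norm_pow, norm_pow, hw, Complex.norm_real, Real.norm_eq_abs, abs_of_nonneg hb0]
    have := pow_le_one₀ hb0 hb1 (n := k)
    rw [one_pow]
    linarith
  have hbk : ∀ k : ℕ, ‖1 - (b : ℂ) ^ k‖ ≤ k * s ^ 2 := by
    intro k
    rw [← Complex.ofReal_one, ← Complex.ofReal_pow, ← Complex.ofReal_sub, Complex.norm_real,
      Real.norm_eq_abs, abs_of_nonneg (sub_nonneg.2 (pow_le_one₀ hb0 hb1))]
    have := one_add_mul_le_pow (a := b - 1) (by linarith) k
    rw [add_sub_cancel] at this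
    rw [hb] at this ⊢
    linarith
  have h6 : ‖1 - (b : ℂ) ^ 6 - 6 * (s : ℂ) ^ 2‖ ≤ 15 * s ^ 4 := by
    have : 1 - (b : ℂ) ^ 6 - 6 * (s : ℂ) ^ 2 = ((1 - b ^ 6 - 6 * s ^ 2 : ℝ) : ℂ) := by
      push_cast
      ring
    rw [this, Complex.norm_real, Real.norm_eq_abs, abs_le, hb]
    obtain ⟨t, ht⟩ : ∃ t, t = s ^ 2 := ⟨_, rfl⟩
    rw [show s ^ 4 = t ^ 2 by rw [ht]; ring, ← ht]
    rw [← ht] at hs1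
    have ht0 : 0 ≤ t := by rw [ht]; positivity
    have ht1 : t ≤ 1 / 100 := by norm_num at hs1; linarith
    have e : 1 - (1 - t) ^ 6 - 6 * t =
        - (15 * t ^ 2) + t ^ 3 * (20 - 15 * t) + t ^ 5 * (6 - t) := by ring
    have p1 : 0 ≤ t ^ 3 * (20 - 15 * t) := mul_nonneg (by positivity) (by linarith)
    have p2 : 0 ≤ t ^ 5 * (6 - t) := mul_nonneg (by positivity) (by linarith)
    have p3 : t ^ 3 * (20 - 15 * t) ≤ 1 * t ^ 2 := by nlinarith [sq_nonneg t, pow_nonneg ht0 3]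
    have p4 : t ^ 5 * (6 - t) ≤ 1 * t ^ 2 := by
      have : t ^ 3 ≤ (1 / 100) ^ 3 := by gcongr
      have : t ^ 3 * (6 - t) ≤ 1 := by nlinarith [pow_nonneg ht0 3]
      nlinarith [sq_nonneg t]
    rw [e]
    constructor <;> linarith [sq_nonneg t]
  refine ⟨(1 - (b : ℂ) ^ 6 - 6 * (s : ℂ) ^ 2) + (E₁ * (1 - (b : ℂ) ^ 5)) * (-(6 / 5)) +
    (E₂ * (1 - (b : ℂ) ^ 4)) * (3 / 2) + (E₃ * (w ^ 3 - (b : ℂ) ^ 3)) * (-2) +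
    (E₄ * (w ^ 2 - (b : ℂ) ^ 2)) * 3 + (E₅ * (w ^ 1 - (b : ℂ) ^ 1)) * (-6), ?_, ?_⟩
  · have m : ∀ {x y : ℂ} {A B : ℝ}, ‖x‖ ≤ A → ‖y‖ ≤ B → ‖x * y‖ ≤ A * B := by
      intro x y A B hx hy
      rw [norm_mul]
      exact mul_le_mul hx hy (norm_nonneg _) ((norm_nonneg _).trans hx)
    refine (norm_add_mul_le (norm_add_mul_le (norm_add_mul_le (norm_add_mul_le (norm_add_mul_le h6
      (m h₁ (hbk 5)) (D := 6 / 5) (by norm_num)) (m h₂ (hbk 4)) (D := 3 / 2) (by norm_num))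
      (m h₃ (hbn 3)) (D := 2) (by norm_num)) (m h₄ (hbn 2)) (D := 3) (by norm_num))
      (m h₅ (hbn 1)) (D := 6) (by norm_num)).trans ?_
    have q4 : s ^ 4 ≤ 1 / 10 ^ 10 * s ^ 3 := by
      rw [pow_succ' s 3]
      gcongr
    have q5 : s ^ 5 ≤ 1 / 10 ^ 20 * s ^ 3 := by
      rw [show s ^ 5 = s ^ 2 * s ^ 3 by ring]
      gcongr
    push_cast
    have := pow_pos hs 3
    norm_num at q4 q5 ⊢
    ring_nf at q4 q5 ⊢
    linarith
  · rw [hw6]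
    ring

theorem derivative_root_of_unity_expansion {s : ℝ} (hs : 0 < s) (hs' : s ≤ 1 / 10 ^ 10)
    {E₁ E₂ E₃ E₄ E₅ w : ℂ} (hw : ‖w‖ = 1) (hw6 : w ^ 6 = 1)
    (h₁ : ‖E₁‖ ≤ 5 * (17 * s)) (h₂ : ‖E₂‖ ≤ 10 * (17 * s) ^ 2) (h₃ : ‖E₃‖ ≤ 10 * (17 * s) ^ 3)
    (h₄ : ‖E₄‖ ≤ 5 * (17 * s) ^ 4) (h₅ : ‖E₅‖ ≤ (17 * s) ^ 5) :
    ∃ T : ℂ, ‖T‖ ≤ 86 * s ∧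
      w * (6 * (w ^ 5 - E₁ * w ^ 4 + E₂ * w ^ 3 - E₃ * w ^ 2 + E₄ * w - E₅)) = 6 + 6 * T := by
  refine ⟨0 + E₁ * (-w ^ 5) + E₂ * w ^ 4 + E₃ * (-w ^ 3) + E₄ * w ^ 2 + E₅ * (-w), ?_, ?_⟩
  · refine (norm_add_mul_le (norm_add_mul_le (norm_add_mul_le (norm_add_mul_le (norm_add_mul_le
      norm_zero.le h₁ (D := 1) ?_) h₂ (D := 1) ?_) h₃ (D := 1) ?_) h₄ (D := 1) ?_)
      h₅ (D := 1) ?_).trans ?_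
    any_goals simp [hw]
    have q : ∀ k : ℕ, s ^ (k + 2) ≤ 1 / 10 ^ 10 * s := by
      intro k
      calc s ^ (k + 2) = s ^ k * s * s := by ring
        _ ≤ 1 * s * s := by
          gcongr
          exact pow_le_one₀ hs.le (hs'.trans (by norm_num))
        _ ≤ _ := by rw [one_mul]; gcongr
    have q2 := q 0
    have q3 := q 1
    have q4 := q 2
    have q5 := q 3
    norm_num at q2 q3 q4 q5 ⊢
    ring_nf at q2 q3 q4 q5 ⊢
    linarith
  · linear_combination 6 * hw6

/-- The constraint `1 - 7 / 20 s² ≤ ‖1 - s² - a‖` for a small `a`, solved for the real part. -/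
theorem re_le_of_far {s : ℝ} {a : ℂ} (hs : s ^ 2 ≤ 1) (ha : |a.re| ≤ 115 * s ^ 2)
    (h : 1 - 7 / 20 * s ^ 2 ≤ ‖((1 - s ^ 2 : ℝ) : ℂ) - a‖) :
    a.re ≤ -(13 / 20) * s ^ 2 + (a.im ^ 2 - a.re ^ 2) / 2 + 15000 * s ^ 4 := by
  have h2 : (1 - 7 / 20 * s ^ 2) ^ 2 ≤ ‖((1 - s ^ 2 : ℝ) : ℂ) - a‖ ^ 2 := by
    gcongr
    linarith
  rw [Complex.sq_norm, Complex.normSq_apply] at h2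
  simp only [Complex.sub_re, Complex.sub_im, Complex.ofReal_re, Complex.ofReal_im] at h2
  rw [abs_le] at ha
  -- Expansion produces `(im² + re²)/2`; the sign of `re²` is flipped at cost `O(s⁴)`, so that the
  -- quadratic term becomes `-Re(a²)/2`.
  have h3 : a.re ^ 2 ≤ (115 * s ^ 2) ^ 2 := sq_le_sq' ha.1 ha.2
  have h4 : s ^ 2 * a.re ≤ s ^ 2 * (115 * s ^ 2) := by
    gcongr
    exact ha.2
  nlinarith [sq_nonneg (s ^ 2)]

theorem cube_root_of_unity {d : ℝ} (hd2 : d ^ 2 = 3 / 4) :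
    ‖(⟨-1 / 2, d⟩ : ℂ)‖ = 1 ∧ (⟨-1 / 2, d⟩ : ℂ) ^ 6 = 1 ∧
      (⟨-1 / 2, d⟩ : ℂ) ^ 4 = ⟨-1 / 2, d⟩ ∧ (⟨-1 / 2, d⟩ : ℂ) ^ 5 = ⟨-1 / 2, -d⟩ := by
  have hw : ‖(⟨-1 / 2, d⟩ : ℂ)‖ = 1 := by
    rw [← Real.sqrt_sq (norm_nonneg _), Complex.sq_norm, Complex.normSq_apply]
    rw [show (-1 / 2 : ℝ) * (-1 / 2) + d * d = 1 by nlinarith, Real.sqrt_one]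
  have hw2 : (⟨-1 / 2, d⟩ : ℂ) ^ 2 = ⟨-1 / 2, -d⟩ := by
    rw [pow_two]
    apply Complex.ext
    · simp; nlinarith
    · simp; ring
  have hw3 : (⟨-1 / 2, d⟩ : ℂ) ^ 3 = 1 := by
    rw [pow_succ, hw2]
    apply Complex.ext
    · simp; nlinarith
    · simp; ring
  have hw6 : (⟨-1 / 2, d⟩ : ℂ) ^ 6 = 1 := by
    rw [show 6 = 3 * 2 by norm_num, pow_mul, hw3, one_pow]
  have hw4 : (⟨-1 / 2, d⟩ : ℂ) ^ 4 = ⟨-1 / 2, d⟩ := by rw [pow_succ, hw3, one_mul]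
  have hw5 : (⟨-1 / 2, d⟩ : ℂ) ^ 5 = ⟨-1 / 2, -d⟩ := by
    rw [show 5 = 3 + 2 by norm_num, pow_add, hw3, hw2, one_mul]
  exact ⟨hw, hw6, hw4, hw5⟩

theorem re_expansion_cube_root (s d : ℝ) (E₁ E₂ R : ℂ) :
    (6 * (s : ℂ) ^ 2 - 6 / 5 * E₁ * ((⟨-1 / 2, -d⟩ : ℂ) - 1) +
      3 / 2 * E₂ * ((⟨-1 / 2, d⟩ : ℂ) - 1) + R).re =
      6 * s ^ 2 + 9 / 5 * E₁.re - 6 / 5 * d * E₁.im - 9 / 4 * E₂.re - 3 / 2 * d * E₂.im + R.re := by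
  have c1 : (6 * (s : ℂ) ^ 2).re = 6 * s ^ 2 := by
    rw [show 6 * (s : ℂ) ^ 2 = ((6 * s ^ 2 : ℝ) : ℂ) by push_cast; ring, Complex.ofReal_re]
  have c2 : (6 / 5 * E₁ * ((⟨-1 / 2, -d⟩ : ℂ) - 1)).re = -(9 / 5) * E₁.re + 6 / 5 * d * E₁.im := by
    rw [show 6 / 5 * E₁ * ((⟨-1 / 2, -d⟩ : ℂ) - 1) =
      ((6 / 5 : ℝ) : ℂ) * (E₁ * ((⟨-1 / 2, -d⟩ : ℂ) - 1)) by push_cast; ring,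
      Complex.re_ofReal_mul]
    simp
    ring
  have c3 : (3 / 2 * E₂ * ((⟨-1 / 2, d⟩ : ℂ) - 1)).re = -(9 / 4) * E₂.re - 3 / 2 * d * E₂.im := by
    rw [show 3 / 2 * E₂ * ((⟨-1 / 2, d⟩ : ℂ) - 1) =
      ((3 / 2 : ℝ) : ℂ) * (E₂ * ((⟨-1 / 2, d⟩ : ℂ) - 1)) by push_cast; ring,
      Complex.re_ofReal_mul]
    simp
    ring
  rw [Complex.add_re, Complex.add_re, Complex.sub_re, c1, c2, c3]
  ring

theorem norm_expansion_le {s M : ℝ} (hs3 : s ^ 3 ≤ 1 / 10 ^ 10 * s ^ 2) {E₁ E₂ R w : ℂ}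
    (hw : ‖w‖ = 1) (hM : ‖E₁‖ ≤ M) (n₂ : ‖E₂‖ ≤ 10 * (17 * s) ^ 2)
    (hR : ‖R‖ ≤ 200000 * s ^ 3) :
    ‖6 * (s : ℂ) ^ 2 - 6 / 5 * E₁ * (w ^ 5 - 1) + 3 / 2 * E₂ * (w ^ 4 - 1) + R‖ ≤
      12 / 5 * M + 9000 * s ^ 2 := by
  have hwk : ∀ k : ℕ, ‖w ^ k - 1‖ ≤ 2 := fun k => by
    refine (norm_sub_le _ _).trans ?_
    rw [norm_pow, hw]
    norm_num
  have m1 : ‖6 / 5 * E₁‖ ≤ 6 / 5 * M := by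
    rw [norm_mul]
    norm_num
    linarith
  have m2 : ‖3 / 2 * E₂‖ ≤ 3 / 2 * (10 * (17 * s) ^ 2) := by
    rw [norm_mul]
    norm_num at n₂ ⊢
    linarith
  have m0 : ‖R + ((6 * s ^ 2 : ℝ) : ℂ) * 1‖ ≤ _ := norm_add_mul_le hR
    (B := 6 * s ^ 2) (by rw [Complex.norm_real, Real.norm_eq_abs, abs_of_nonneg (by positivity)])
    norm_one.le
  have hall := norm_add_mul_le (norm_add_mul_le m0 m1 ((norm_neg _).trans_le (hwk 5)))
    m2 (hwk 4)
  have heq : 6 * (s : ℂ) ^ 2 - 6 / 5 * E₁ * (w ^ 5 - 1) + 3 / 2 * E₂ * (w ^ 4 - 1) + R = R + ((6 * s ^ 2 : ℝ) : ℂ) * 1 + 6 / 5 * E₁ * -(w ^ 5 - 1) +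
      3 / 2 * E₂ * (w ^ 4 - 1) := by
    push_cast
    ring
  rw [heq]
  refine hall.trans ?_
  norm_num at hs3
  linarith [sq_nonneg s]

/-! ### Degree 6: the contradiction and the upper bound. -/

-- A bootstrap. Using only `E₁ = O(s)`, the inequalities at the two cube roots hold up to `O(s²)`
-- and force `Im E₁ = O(s²)`. Hence `E₁ = O(s²)` and `P(w) = O(s²)`, so the same inequalities hold
-- up to `O(s³)`, enough to compare coefficients of `s²`.
set_option maxHeartbeats 1000000 in
theorem sextic_contradiction {s : ℝ} (hs : 0 < s) (hs' : s ≤ 1 / 10 ^ 10) {P : ℂ[X]}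
    (hr : ∀ z, P.IsRoot z → ‖z‖ ≤ 1) (hb : P.eval ((1 - s ^ 2 : ℝ) : ℂ) = 0)
    {a₁ a₂ a₃ a₄ a₅ : ℂ}
    (hd : ∀ z, P.derivative.eval z =
      6 * ((z - a₁) * (z - a₂) * (z - a₃) * (z - a₄) * (z - a₅)))
    (h₁ : ‖a₁‖ ≤ 17 * s ∧ |a₁.re| ≤ 115 * s ^ 2) (h₂ : ‖a₂‖ ≤ 17 * s ∧ |a₂.re| ≤ 115 * s ^ 2)
    (h₃ : ‖a₃‖ ≤ 17 * s ∧ |a₃.re| ≤ 115 * s ^ 2) (h₄ : ‖a₄‖ ≤ 17 * s ∧ |a₄.re| ≤ 115 * s ^ 2)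
    (h₅ : ‖a₅‖ ≤ 17 * s ∧ |a₅.re| ≤ 115 * s ^ 2)
    (f₁ : 1 - 7 / 20 * s ^ 2 ≤ ‖((1 - s ^ 2 : ℝ) : ℂ) - a₁‖)
    (f₂ : 1 - 7 / 20 * s ^ 2 ≤ ‖((1 - s ^ 2 : ℝ) : ℂ) - a₂‖)
    (f₃ : 1 - 7 / 20 * s ^ 2 ≤ ‖((1 - s ^ 2 : ℝ) : ℂ) - a₃‖)
    (f₄ : 1 - 7 / 20 * s ^ 2 ≤ ‖((1 - s ^ 2 : ℝ) : ℂ) - a₄‖)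
    (f₅ : 1 - 7 / 20 * s ^ 2 ≤ ‖((1 - s ^ 2 : ℝ) : ℂ) - a₅‖) : False := by
  have hss : s ^ 2 ≤ 1 / 10 ^ 10 * s := by rw [pow_two]; gcongr
  have hs3 : s ^ 3 ≤ 1 / 10 ^ 10 * s ^ 2 := by rw [pow_succ' s 2]; gcongr
  have hs2 : s ^ 2 ≤ 1 := by norm_num at hss hs'; linarith
  have hs4 : s ^ 4 ≤ s ^ 3 := by
    rw [pow_succ' s 3]
    have : s ≤ 1 := by norm_num at hs'; linarith
    nlinarith [pow_pos hs 3]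
  have hp2 : 0 < s ^ 2 := by positivity
  obtain ⟨E₁, E₂, E₃, E₄, E₅, hE₁, hE₂, hprod, n₁, n₂, n₃, n₄, n₅⟩ :=
    elementary_symmetric_bounds h₁.1 h₂.1 h₃.1 h₄.1 h₅.1
  simp only [hprod] at hd
  have hP := eval_eq_of_derivative hb hd
  have hreE : |E₁.re| ≤ 575 * s ^ 2 := by
    have k₁ := abs_le.1 h₁.2
    have k₂ := abs_le.1 h₂.2
    have k₃ := abs_le.1 h₃.2
    have k₄ := abs_le.1 h₄.2
    have k₅ := abs_le.1 h₅.2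
    rw [hE₁, abs_le]
    simp only [Complex.add_re]
    constructor <;> linarith
  -- Since `2 E₂ = E₁² - ∑ aᵢ²`, the terms `-Re(aᵢ²)/2` cancel exactly in `E₁ - E₂`; `13/4 = 5 ·
  -- 13/20`.
  have hdiff : E₁.re - E₂.re ≤ -(13 / 4) * s ^ 2 + E₁.im ^ 2 / 2 + 75000 * s ^ 4 := by
    have g₁ := re_le_of_far hs2 h₁.2 f₁
    have g₂ := re_le_of_far hs2 h₂.2 f₂
    have g₃ := re_le_of_far hs2 h₃.2 f₃
    have g₄ := re_le_of_far hs2 h₄.2 f₄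
    have g₅ := re_le_of_far hs2 h₅.2 f₅
    have e1 := congrArg Complex.re hE₁
    have e2 := congrArg Complex.re hE₂
    simp [pow_two] at e1 e2
    nlinarith [sq_nonneg E₁.re]
  have expand : ∀ w : ℂ, ‖w‖ = 1 → w ^ 6 = 1 → ∃ R : ℂ, ‖R‖ ≤ 200000 * s ^ 3 ∧
      P.eval w = 6 * s ^ 2 - 6 / 5 * E₁ * (w ^ 5 - 1) + 3 / 2 * E₂ * (w ^ 4 - 1) + R ∧
      -(86 * s * ‖P.eval w‖) ≤ (P.eval w).re := by
    intro w hw hw6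
    obtain ⟨R, hR, hR'⟩ := eval_root_of_unity_expansion hs hs' hw hw6 n₁ n₂ n₃ n₄ n₅
    obtain ⟨T, hT, hT'⟩ := derivative_root_of_unity_expansion hs hs' hw hw6 n₁ n₂ n₃ n₄ n₅
    refine ⟨R, hR, (hP w).trans hR', neg_mul_norm_le_re hT ?_⟩
    rw [← hT', ← hd]
    exact re_mul_derivative_mul_conj_nonneg hr hw
  have size : ∀ w : ℂ, ‖w‖ = 1 → w ^ 6 = 1 → ∀ M, ‖E₁‖ ≤ M →
      ‖P.eval w‖ ≤ 12 / 5 * M + 9000 * s ^ 2 := by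
    intro w hw hw6 M hM
    obtain ⟨R, hR, hR', -⟩ := expand w hw hw6
    rw [hR']
    exact norm_expansion_le hs3 hw hM n₂ hR
  have cube : ∀ d : ℝ, d ^ 2 = 3 / 4 → ‖(⟨-1 / 2, d⟩ : ℂ)‖ = 1 ∧ (⟨-1 / 2, d⟩ : ℂ) ^ 6 = 1 ∧
      ∃ r : ℝ, |r| ≤ 200000 * s ^ 3 ∧ (P.eval ⟨-1 / 2, d⟩).re =
        6 * s ^ 2 + 9 / 5 * E₁.re - 6 / 5 * d * E₁.im - 9 / 4 * E₂.re - 3 / 2 * d * E₂.im + r := by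
    intro d hd2
    obtain ⟨hw, hw6, hw4, hw5⟩ := cube_root_of_unity hd2
    refine ⟨hw, hw6, ?_⟩
    obtain ⟨R, hR, hR', -⟩ := expand _ hw hw6
    refine ⟨R.re, (Complex.abs_re_le_norm R).trans hR, ?_⟩
    rw [hR', hw4, hw5, re_expansion_cube_root]
  obtain ⟨d, hd0, hd2⟩ : ∃ d : ℝ, 1 / 2 ≤ d ∧ d ^ 2 = 3 / 4 := by
    refine ⟨√(3 / 4), Real.le_sqrt_of_sq_le (by norm_num), Real.sq_sqrt (by norm_num)⟩
  obtain ⟨v1, v6, r, hr1, hr2⟩ := cube d hd2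
  obtain ⟨v1', v6', r', hr1', hr2'⟩ := cube (-d) (by rw [neg_sq, hd2])
  have lower : ∀ w : ℂ, ‖w‖ = 1 → w ^ 6 = 1 → ∀ M, ‖E₁‖ ≤ M →
      -(86 * s * (12 / 5 * M + 9000 * s ^ 2)) ≤ (P.eval w).re := by
    intro w hw hw6 M hM
    obtain ⟨-, -, -, h⟩ := expand w hw hw6
    have h1 : 86 * s * ‖P.eval w‖ ≤ 86 * s * (12 / 5 * M + 9000 * s ^ 2) := by
      gcongr
      exact size w hw hw6 M hM
    linarith
  have n₂' : |E₂.re| ≤ 2890 * s ^ 2 ∧ |E₂.im| ≤ 2890 * s ^ 2 :=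
    ⟨(Complex.abs_re_le_norm _).trans (n₂.trans_eq (by ring)),
      (Complex.abs_im_le_norm _).trans (n₂.trans_eq (by ring))⟩
  have hd1 : d ≤ 1 := by nlinarith
  -- `d * E₁.im` enters with opposite signs at the two conjugate roots and everything else is
  -- `O(s²)`, so it is bounded on both sides.
  have himE : |E₁.im| ≤ 100000 * s ^ 2 := by
    have l1 := lower _ v1 v6 _ n₁
    have l2 := lower _ v1' v6' _ n₁
    rw [hr2] at l1
    rw [hr2'] at l2
    have x1 := abs_le.1 hr1
    have x2 := abs_le.1 hr1'
    have x3 := abs_le.1 hreE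
    have x4 := abs_le.1 n₂'.1
    have x5 : |d * E₂.im| ≤ 1 * (2890 * s ^ 2) := by
      rw [abs_mul, abs_of_nonneg (by linarith)]
      exact mul_le_mul hd1 n₂'.2 (abs_nonneg _) zero_le_one
    have x6 := abs_le.1 x5
    norm_num at hs3
    have x7 : |d * E₁.im| ≤ 50000 * s ^ 2 := by
      rw [abs_le]
      constructor <;> linarith only [l1, l2, x1.1, x1.2, x2.1, x2.2, x3.1, x3.2, x4.1, x4.2, x6.1,
        x6.2, hs3, hp2]
    rw [abs_mul, abs_of_nonneg (by linarith only [hd0])] at x7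
    linarith only [x7, mul_nonneg (sub_nonneg.2 hd0) (abs_nonneg E₁.im)]
  have hE₁n : ‖E₁‖ ≤ 110000 * s ^ 2 := by
    refine (Complex.norm_le_abs_re_add_abs_im _).trans ?_
    linarith
  have l1 := lower _ v1 v6 _ hE₁n
  have l2 := lower _ v1' v6' _ hE₁n
  have l3 := lower (-1) (by simp) (by norm_num) _ hE₁n
  obtain ⟨R, hR, hR', -⟩ := expand (-1) (by simp) (by norm_num)
  have hneg : (P.eval (-1)).re = 6 * s ^ 2 + 12 / 5 * E₁.re + R.re := by
    rw [hR', show (6 * (s : ℂ) ^ 2 - 6 / 5 * E₁ * ((-1) ^ 5 - 1) + 3 / 2 * E₂ * ((-1) ^ 4 - 1) + R) =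
      ((6 * s ^ 2 : ℝ) : ℂ) + ((12 / 5 : ℝ) : ℂ) * E₁ + R by push_cast; ring,
      Complex.add_re, Complex.add_re, Complex.ofReal_re, Complex.re_ofReal_mul]
  rw [hr2] at l1
  rw [hr2'] at l2
  rw [hneg] at l3
  have x1 := abs_le.1 hr1
  have x2 := abs_le.1 hr1'
  have x3 := abs_le.1 ((Complex.abs_re_le_norm R).trans hR)
  have x4 : E₁.im ^ 2 ≤ (100000 * s ^ 2) ^ 2 := by
    rw [← sq_abs]
    gcongr
  -- This is `4/3 (l1 + l2) + 1/2 l3`: the imaginary parts cancel between conjugates, and the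
  -- weights make the coefficients of `E₁.re` and `E₂.re` opposite. With `hdiff` the coefficient of
  -- `s²` becomes `19 - 39/2 < 0`.
  have hcomb : 0 ≤ 19 * s ^ 2 + 6 * (E₁.re - E₂.re) + 10 ^ 8 * s ^ 3 := by
    linarith only [l1, l2, l3, x1.2, x2.2, x3.2, pow_pos hs 3]
  have hs4' : s ^ 4 ≤ 1 / 10 ^ 20 * s ^ 2 := by
    rw [show s ^ 4 = s ^ 2 * s ^ 2 by ring]
    gcongr
    calc s ^ 2 ≤ (1 / 10 ^ 10) ^ 2 := by gcongr
      _ = _ := by norm_num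
  norm_num at hs3 hs4'
  linarith only [hcomb, hdiff, x4, hs3, hs4', hp2]

theorem exists_isRoot_derivative_near {s : ℝ} (hs : 0 < s) (hs' : s ≤ 1 / 10 ^ 10) {P : ℂ[X]}
    (hP : P ∈ sendovClass 6 ((1 - s ^ 2 : ℝ) : ℂ)) :
    ∃ z, P.derivative.IsRoot z ∧ ‖((1 - s ^ 2 : ℝ) : ℂ) - z‖ < 1 - 7 / 20 * s ^ 2 := by
  wlog hm : P.Monic generalizing P
  · have hP0 : P ≠ 0 := by rintro rfl; simp [sendovClass] at hP
    have hl : P.leadingCoeff ≠ 0 := leadingCoeff_ne_zero.2 hP0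
    have hroot : ∀ Q : ℂ[X], ∀ z, (Q * C P.leadingCoeff⁻¹).IsRoot z ↔ Q.IsRoot z := by
      intro Q z
      simp [IsRoot.def, hl]
    obtain ⟨z, hz, hz'⟩ := this (P := P * C P.leadingCoeff⁻¹)
      ⟨by rw [degree_mul_C (inv_ne_zero hl)]; exact hP.1,
        fun z hz => hP.2.1 z ((hroot P z).1 hz), (hroot P _).2 hP.2.2⟩
      (monic_mul_leadingCoeff_inv hP0)
    rw [derivative_mul, derivative_C, mul_zero, add_zero, hroot] at hz
    exact ⟨z, hz, hz'⟩
  by_contra! hc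
  have hN : P.natDegree = 6 := natDegree_eq_of_degree_eq_some hP.1
  have hDN : P.derivative.natDegree = 5 := by
    rw [natDegree_derivative, hN]
  have hDl : P.derivative.leadingCoeff = 6 := by
    rw [leadingCoeff, hDN, coeff_derivative]
    have : P.coeff 6 = 1 := by rw [← hN]; exact hm
    norm_num [this]
  have hcard : P.derivative.roots.card = 5 := by
    rw [← (IsAlgClosed.splits P.derivative).natDegree_eq_card_roots, hDN]
  obtain ⟨l, hl⟩ := Quotient.exists_rep P.derivative.roots
  replace hl : (l : Multiset ℂ) = P.derivative.roots := hl
  rw [← hl, Multiset.coe_card] at hcard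
  match l, hcard with
  | [a₁, a₂, a₃, a₄, a₅], _ =>
    have hd : ∀ z, P.derivative.eval z =
        6 * ((z - a₁) * (z - a₂) * (z - a₃) * (z - a₄) * (z - a₅)) := by
      intro z
      rw [(IsAlgClosed.splits P.derivative).eval_eq_prod_roots, hDl, ← hl]
      simp
      ring
    have hroot : ∀ a ∈ [a₁, a₂, a₃, a₄, a₅], P.derivative.IsRoot a := by
      intro a ha
      apply isRoot_of_mem_roots
      rw [← hl]
      exact Multiset.mem_coe.2 ha
    have bnd : ∀ a ∈ [a₁, a₂, a₃, a₄, a₅], ‖a‖ ≤ 17 * s ∧ |a.re| ≤ 115 * s ^ 2 := fun a ha =>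
      critical_points_bounds hs (hs'.trans (by norm_num)) hm hP hc (hroot a ha)
    have far := fun a ha => hc a (hroot a ha)
    simp only [List.forall_mem_cons] at bnd far
    exact sextic_contradiction hs hs' hP.2.1 hP.2.2 hd bnd.1 bnd.2.1 bnd.2.2.1 bnd.2.2.2.1
      bnd.2.2.2.2.1 far.1 far.2.1 far.2.2.1 far.2.2.2.1 far.2.2.2.2.1

/-! ### Comparison of the two radii. -/

theorem sendovRadius_six_le {e : ℝ} (he : 0 < e) (he' : e ≤ 1 / 10 ^ 20) :
    sendovRadius 6 ((1 - e : ℝ) : ℂ) ≤ 1 - 7 / 20 * e := by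
  have hs : 0 < √e := Real.sqrt_pos.2 he
  have hs' : √e ≤ 1 / 10 ^ 10 := by
    rw [Real.sqrt_le_left (by norm_num)]
    exact he'.trans (by norm_num)
  have hsq : √e ^ 2 = e := Real.sq_sqrt he.le
  -- The second goal, nonnegativity of the bound, covers the convention `sSup ∅ = 0`.
  apply Real.sSup_le
  · rintro _ ⟨P, hP, rfl⟩
    rw [← hsq] at hP
    obtain ⟨z, hz, hz'⟩ := exists_isRoot_derivative_near hs hs' hP
    rw [hsq, ← dist_eq_norm] at hz'
    have h := Metric.infDist_le_dist_of_mem (s := {z | P.derivative.IsRoot z})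
      (x := ((1 - e : ℝ) : ℂ)) hz
    exact h.trans hz'.le
  · norm_num at he'
    linarith

theorem corollary4 :
    ∃ δ : ℝ, 0 < δ ∧ ∀ β : ℂ, 1 - δ < ‖β‖ → ‖β‖ < 1 →
      sendovRadius 6 β < sendovRadius 4 β ∧
        ¬ MonotoneOn (fun n : ℕ => sendovRadius n β) (Set.Ici 2) := by
  refine ⟨1 / 10 ^ 20, by norm_num, fun β h1 h2 => ?_⟩
  have hβ : β ≠ 0 := by
    rintro rfl
    norm_num at h1
  have hlt : sendovRadius 6 β < sendovRadius 4 β := by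
    rw [sendovRadius_eq_norm 6 β hβ, sendovRadius_eq_norm 4 β hβ]
    have h6 := sendovRadius_six_le (e := 1 - ‖β‖) (by linarith) (by linarith)
    have h4 := le_sendovRadius_four (e := 1 - ‖β‖) (by linarith) (by norm_num at h1; linarith)
    rw [sub_sub_cancel] at h4 h6
    linarith
  refine ⟨hlt, fun hmono => ?_⟩
  exact (hmono (by norm_num : (4 : ℕ) ∈ Set.Ici 2) (by norm_num : (6 : ℕ) ∈ Set.Ici 2)
    (by norm_num)).not_gt hlt
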